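/- Let $X$ be a finite-dimensional real Hilbert space, let $m\ge 1$, and let $U_1,\dots,U_m$ be closed convex subsets of $X$ with $\bigcap_{i=1}^m \operatorname{ri} U_i\neq\varnothing$, where $\operatorname{ri}$ denotes the relative interior. Set $U_{m+1}=U_1$. Let $P_C$ denote the projector onto a nonempty closed convex set $C$, and put $R_C=2P_C-\mathrm{Id}$. For $i=1,\dots,m$ let $$T_i=P_{U_{i+1}}R_{U_i}+\mathrm{Id}-P_{U_i}$$ be the Douglas--Rachford operator of the pair $(U_i,U_{i+1})$, and let $T=T_mT_{m-1}\cdots T_2T_1$. Then for every $x_0\in X$ the sequence $(T^nx_0)_{n\in\mathbb N}$ generated by the Borwein--Tam method converges with a linear rate to a point $\bar x\in\bigcap_{i=1}^m\operatorname{Fix}T_i$ with $P_{U_1}\bar x=\dots=P_{U_m}\bar x\in\bigcap_{i=1}^m U_i$. That is, there are $K\ge 0$ and $\alpha\in[0,1)$, which may depend on $x_0$, such that $$\|T^nx_0-\bar x\|\le K\alpha^n\qquad\text{for all } n\in\mathbb N.$$ -/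

import Mathlib

open Set Filter Topology

namespace BorweinTam

variable {X : Type*} [NormedAddCommGroup X] [InnerProductSpace ℝ X]

/-- `p` is a point of `C` nearest to `x`. -/
def IsNearest (C : Set X) (x p : X) : Prop :=
  p ∈ C ∧ ∀ q ∈ C, ‖x - p‖ ≤ ‖x - q‖

open Classical in
/-- The projector `P_C`: a nearest point of `C` to `x` if there is one (it exists and is unique
when `C` is nonempty, closed and convex, see below), and `x` otherwise. -/
noncomputable def proj (C : Set X) (x : X) : X :=
  if h : ∃ p, IsNearest C x p then h.choose else x

/-- The reflector `R_C = 2 P_C - Id`. -/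
noncomputable def reflector (C : Set X) (x : X) : X :=
  (2 : ℝ) • proj C x - x

/-- The Douglas--Rachford operator `P_B R_A + Id - P_A` of the ordered pair `(A, B)`. -/
noncomputable def douglasRachford (A B : Set X) (x : X) : X :=
  proj B (reflector A x) + x - proj A x

/-- The operators `T_i = P_{U_{i+1}} R_{U_i} + Id - P_{U_i}`. The indices run through `Fin m`,
where addition is modulo `m`, so that the last set is followed by the first one. -/
noncomputable def stepOp {m : ℕ} [NeZero m] (U : Fin m → Set X) (i : Fin m) : X → X :=
  douglasRachford (U i) (U (i + 1))

/-- The Borwein--Tam operator: the composition of all `stepOp U i`, the one with the smallest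
index being applied first. -/
noncomputable def borweinTam {m : ℕ} [NeZero m] (U : Fin m → Set X) (x : X) : X :=
  (List.finRange m).foldl (fun y i => stepOp U i y) x

/-- Linear convergence of the sequence `x` to `l`. -/
def ConvergesLinearly (x : ℕ → X) (l : X) : Prop :=
  ∃ (K α : ℝ), 0 ≤ K ∧ 0 ≤ α ∧ α < 1 ∧ ∀ n, ‖x n - l‖ ≤ K * α ^ n

/-- Existence and uniqueness of the projection onto a nonempty closed convex set. -/
theorem isNearest_iff_eq_proj [CompleteSpace X] {C : Set X} (hne : C.Nonempty)
    (hcl : IsClosed C) (hcv : Convex ℝ C) (x p : X) : IsNearest C x p ↔ p = proj C x := by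
  have key : ∀ q, IsNearest C x q ↔ q ∈ C ∧ ∀ w ∈ C, inner ℝ (x - q) (w - q) ≤ 0 := by
    intro q
    refine and_congr_right fun hq => ?_
    rw [← norm_eq_iInf_iff_real_inner_le_zero hcv hq]
    haveI : Nonempty C := hne.to_subtype
    have hb : BddBelow (Set.range fun w : C => ‖x - w‖) :=
      ⟨0, by rintro _ ⟨w, rfl⟩; exact norm_nonneg _⟩
    constructor
    · intro h
      exact le_antisymm (le_ciInf fun w => h w w.2) (ciInf_le hb ⟨q, hq⟩)
    · intro h w hw
      rw [h]
      exact ciInf_le hb ⟨w, hw⟩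
  have uniq : ∀ a b, IsNearest C x a → IsNearest C x b → a = b := by
    intro a b ha hb
    have h1 := ((key a).1 ha).2 b hb.1
    have h2 := ((key b).1 hb).2 a ha.1
    have h3 : inner ℝ (a - b) (a - b) = inner ℝ (x - a) (b - a) + inner ℝ (x - b) (a - b) := by
      simp only [inner_sub_left, inner_sub_right, real_inner_comm]
      ring
    have h4 : inner ℝ (a - b) (a - b) = (0 : ℝ) :=
      le_antisymm (by rw [h3]; linarith) real_inner_self_nonneg
    exact sub_eq_zero.1 (inner_self_eq_zero.1 h4)
  obtain ⟨v, hv, hmin⟩ := exists_norm_eq_iInf_of_complete_convex hne hcl.isComplete hcv x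
  have hex : ∃ q, IsNearest C x q :=
    ⟨v, (key v).2 ⟨hv, (norm_eq_iInf_iff_real_inner_le_zero hcv hv).1 hmin⟩⟩
  have hp : IsNearest C x (proj C x) := by
    rw [proj, dif_pos hex]
    exact hex.choose_spec
  exact ⟨fun h => uniq _ _ h hp, fun h => h ▸ hp⟩

end BorweinTam

namespace BorweinTam

variable {X : Type*} [NormedAddCommGroup X] [InnerProductSpace ℝ X]

/-! Each `stepOp U i` is firmly nonexpansive, so the decrease of the squared distance to a common
fixed point over one cycle controls every displacement `‖stepOp U i x - x‖`. If these displacements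
in turn bound the distance to the common fixed points on bounded sets, that distance contracts by a
constant factor per cycle, and Fejér monotonicity gives linear convergence.

The error bound (`exists_orthogonal_norm_sub_le`) uses `c` in all relative interiors. Let `L i` be
the direction of the affine hull of `U i`. Points `z + w` with `z` in every `U i` and `w` orthogonal
to every `L i` are fixed by all steps. If all steps at `x` are short, the projections of `x` onto
the sets nearly agree, hence lie near a common point `z`, and `x` minus its first projection is
nearly orthogonal to every `L i`, hence near such a `w`. -/

theorem isNearest_iff_inner {C : Set X} (hcv : Convex ℝ C) (x p : X) :
    IsNearest C x p ↔ p ∈ C ∧ ∀ w ∈ C, inner ℝ (x - p) (w - p) ≤ 0 := by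
  refine and_congr_right fun hp => ?_
  rw [← norm_eq_iInf_iff_real_inner_le_zero hcv hp]
  have : Nonempty C := ⟨⟨p, hp⟩⟩
  have hb : BddBelow (Set.range fun w : C => ‖x - w‖) :=
    ⟨0, by rintro _ ⟨w, rfl⟩; exact norm_nonneg _⟩
  constructor
  · intro h
    exact le_antisymm (le_ciInf fun w => h w w.2) (ciInf_le hb ⟨p, hp⟩)
  · intro h w hw
    rw [h]
    exact ciInf_le hb ⟨w, hw⟩

/-! ### Firm nonexpansiveness of projectors and Douglas–Rachford operators. -/

section Projector

variable [CompleteSpace X] {C : Set X}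

theorem isNearest_proj (hne : C.Nonempty) (hcl : IsClosed C) (hcv : Convex ℝ C) (x : X) :
    IsNearest C x (proj C x) :=
  (isNearest_iff_eq_proj hne hcl hcv x _).2 rfl

theorem proj_mem (hne : C.Nonempty) (hcl : IsClosed C) (hcv : Convex ℝ C) (x : X) :
    proj C x ∈ C :=
  (isNearest_proj hne hcl hcv x).1

theorem inner_sub_proj_le (hne : C.Nonempty) (hcl : IsClosed C) (hcv : Convex ℝ C) (x : X)
    {w : X} (hw : w ∈ C) : inner ℝ (x - proj C x) (w - proj C x) ≤ 0 :=
  ((isNearest_iff_inner hcv _ _).1 (isNearest_proj hne hcl hcv x)).2 w hw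

theorem norm_sub_proj_le (hne : C.Nonempty) (hcl : IsClosed C) (hcv : Convex ℝ C) (x : X)
    {w : X} (hw : w ∈ C) : ‖x - proj C x‖ ≤ ‖x - w‖ :=
  (isNearest_proj hne hcl hcv x).2 w hw

theorem proj_eq_of_inner (hcl : IsClosed C) (hcv : Convex ℝ C) {x p : X} (hp : p ∈ C)
    (h : ∀ w ∈ C, inner ℝ (x - p) (w - p) ≤ 0) : proj C x = p :=
  ((isNearest_iff_eq_proj ⟨p, hp⟩ hcl hcv x p).1 ((isNearest_iff_inner hcv x p).2 ⟨hp, h⟩)).symm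

theorem proj_firmlyNonexpansive (hne : C.Nonempty) (hcl : IsClosed C) (hcv : Convex ℝ C)
    (x y : X) :
    inner ℝ (proj C x - proj C y) (proj C x - proj C y) ≤
      inner ℝ (proj C x - proj C y) (x - y) := by
  have h1 := inner_sub_proj_le hne hcl hcv x (proj_mem hne hcl hcv y)
  have h2 := inner_sub_proj_le hne hcl hcv y (proj_mem hne hcl hcv x)
  have h : inner ℝ (proj C x - proj C y) (proj C x - proj C y) -
      inner ℝ (proj C x - proj C y) (x - y) =
      inner ℝ (x - proj C x) (proj C y - proj C x) +
      inner ℝ (y - proj C y) (proj C x - proj C y) := by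
    simp only [inner_sub_left, inner_sub_right, real_inner_comm]
    ring
  linarith

end Projector

section DouglasRachford

variable [CompleteSpace X] {A B : Set X}

/-- After expansion this is twice the sum of the firm nonexpansiveness inequalities of the two
projectors. -/
theorem douglasRachford_firmlyNonexpansive (hA : A.Nonempty) (hAcl : IsClosed A)
    (hAcv : Convex ℝ A) (hB : B.Nonempty) (hBcl : IsClosed B) (hBcv : Convex ℝ B) (x y : X) :
    ‖douglasRachford A B x - douglasRachford A B y‖ ^ 2 +
      ‖(x - douglasRachford A B x) - (y - douglasRachford A B y)‖ ^ 2 ≤ ‖x - y‖ ^ 2 := by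
  have h1 := proj_firmlyNonexpansive hA hAcl hAcv x y
  have h2 := proj_firmlyNonexpansive hB hBcl hBcv (reflector A x) (reflector A y)
  obtain ⟨a, ha⟩ : ∃ a, a = proj A x - proj A y := ⟨_, rfl⟩
  obtain ⟨b, hb⟩ : ∃ b, b = proj B (reflector A x) - proj B (reflector A y) := ⟨_, rfl⟩
  obtain ⟨u, hu⟩ : ∃ u, u = x - y := ⟨_, rfl⟩
  have hr : reflector A x - reflector A y = a + a - u := by
    rw [ha, hu, reflector, reflector, two_smul, two_smul]; abel
  have ht : douglasRachford A B x - douglasRachford A B y = b + u - a := by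
    rw [ha, hb, hu, douglasRachford, douglasRachford]; abel
  have hs : (x - douglasRachford A B x) - (y - douglasRachford A B y) = a - b := by
    rw [ha, hb, douglasRachford, douglasRachford]; abel
  rw [hr, ← hb] at h2
  rw [← ha, ← hu] at h1
  rw [ht, hs, ← hu]
  simp only [← real_inner_self_eq_norm_sq, inner_sub_left, inner_sub_right, inner_add_left,
    inner_add_right] at h1 h2 ⊢
  rw [real_inner_comm u b, real_inner_comm u a, real_inner_comm a b] at *
  linarith

end DouglasRachford

/-! ### Displacements along a composition. -/

section Composition

/-- Along a composition of firmly nonexpansive maps, the displacement of each factor at the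
starting point is controlled by the decrease of the distance to a common fixed point. -/
theorem norm_sub_le_of_foldl {ι E : Type*} [NormedAddCommGroup E] (f : ι → E → E)
    (hf : ∀ i x y, ‖f i x - f i y‖ ^ 2 + ‖(x - f i x) - (y - f i y)‖ ^ 2 ≤ ‖x - y‖ ^ 2)
    {y : E} (hy : ∀ i, f i y = y) (l : List ι) (x : E) :
    ‖l.foldl (fun z i => f i z) x - y‖ ≤ ‖x - y‖ ∧
    ∀ D : ℝ, 0 ≤ D → ‖x - y‖ ^ 2 - ‖l.foldl (fun z i => f i z) x - y‖ ^ 2 ≤ D ^ 2 →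
      ∀ i ∈ l, ‖f i x - x‖ ≤ 2 * l.length * D := by
  have hne : ∀ i x z, ‖f i x - f i z‖ ≤ ‖x - z‖ := fun i x z =>
    le_of_pow_le_pow_left₀ two_ne_zero (norm_nonneg _)
      (by linarith [hf i x z, sq_nonneg ‖(x - f i x) - (z - f i z)‖])
  induction l generalizing x with
  | nil => simp
  | cons j l ih =>
    obtain ⟨ih1, ih2⟩ := ih (f j x)
    have hj := hf j x y
    have hjn := hne j x y
    rw [hy j] at hj hjn
    rw [sub_self, sub_zero, norm_sub_rev x (f j x)] at hj
    simp only [List.foldl_cons, List.length_cons, List.mem_cons]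
    refine ⟨ih1.trans hjn, fun D hD h => ?_⟩
    have hsq : ‖l.foldl (fun z i => f i z) (f j x) - y‖ ^ 2 ≤ ‖f j x - y‖ ^ 2 :=
      pow_le_pow_left₀ (norm_nonneg _) ih1 2
    have hs : ‖f j x - x‖ ≤ D := le_of_pow_le_pow_left₀ two_ne_zero hD (by linarith)
    have hlD : 0 ≤ (l.length : ℝ) * D := by positivity
    push_cast
    rintro i (rfl | hi)
    · linarith
    · have h2 := ih2 D hD (by linarith [sq_nonneg ‖f j x - x‖]) i hi
      -- The detour through `f j x` costs `‖f j x - x‖ ≤ D` twice, whence the factor `2 * l.length`.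
      have h3 : f i x - x = (f i x - f i (f j x)) + (f i (f j x) - f j x) + (f j x - x) := by abel
      have h4 := hne i x (f j x)
      rw [norm_sub_rev x] at h4
      rw [h3]
      linarith [norm_add₃_le (a := f i x - f i (f j x)) (b := f i (f j x) - f j x)
        (c := f j x - x)]

end Composition

/-! ### Linear error bound and relative interior balls. -/

section LinearAlgebra

/-- The joint map has a linear right inverse `g` on its range, bounded by finite dimension;
subtracting `g` of the residual lands in the common kernel. -/
theorem exists_norm_sub_le_of_linearMap {ι : Type*} [Fintype ι] [FiniteDimensional ℝ X]
    (A : ι → X →ₗ[ℝ] X) :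
    ∃ K : ℝ, 0 ≤ K ∧ ∀ (v : X) (δ : ℝ), 0 ≤ δ → (∀ i, ‖A i v‖ ≤ δ) →
      ∃ w, (∀ i, A i w = 0) ∧ ‖v - w‖ ≤ K * δ := by
  obtain ⟨g, hg⟩ := (LinearMap.pi A).rangeRestrict.exists_rightInverse_of_surjective
    (LinearMap.range_rangeRestrict _)
  refine ⟨‖LinearMap.toContinuousLinearMap g‖,
    norm_nonneg (LinearMap.toContinuousLinearMap g), fun v δ hδ h => ?_⟩
  refine ⟨v - g ((LinearMap.pi A).rangeRestrict v), fun i => ?_, ?_⟩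
  · have h1 := LinearMap.congr_fun hg ((LinearMap.pi A).rangeRestrict v)
    have h2 : A i (g ((LinearMap.pi A).rangeRestrict v)) = A i v :=
      congrFun (congrArg Subtype.val h1) i
    rw [map_sub, h2, sub_self]
  · rw [sub_sub_cancel]
    refine ((LinearMap.toContinuousLinearMap g).le_opNorm
      ((LinearMap.pi A).rangeRestrict v)).trans ?_
    refine mul_le_mul_of_nonneg_left ?_ (norm_nonneg _)
    exact (pi_norm_le_iff_of_nonneg hδ).2 h

end LinearAlgebra

theorem exists_forall_add_mem_of_mem_intrinsicInterior {ι : Type*} [Finite ι] (U : ι → Set X)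
    {c : X} (hc : ∀ i, c ∈ intrinsicInterior ℝ (U i)) :
    ∃ r : ℝ, 0 < r ∧ ∀ i, ∀ v ∈ (affineSpan ℝ (U i)).direction, ‖v‖ ≤ r → c + v ∈ U i := by
  have h : ∀ᶠ r : ℝ in 𝓝[>] 0, ∀ i, ∀ v ∈ (affineSpan ℝ (U i)).direction, ‖v‖ ≤ r →
      c + v ∈ U i := by
    rw [eventually_all]
    intro i
    obtain ⟨y, hy, rfl⟩ := mem_intrinsicInterior.1 (hc i)
    rw [mem_interior_iff_mem_nhds, Metric.mem_nhds_iff] at hy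
    obtain ⟨ε, hε, hball⟩ := hy
    filter_upwards [Ioo_mem_nhdsGT hε] with r hr v hv hvr
    have hmem : (y : X) + v ∈ affineSpan ℝ (U i) := by
      rw [add_comm]
      exact AffineSubspace.vadd_mem_of_mem_direction hv y.2
    have : (⟨(y : X) + v, hmem⟩ : affineSpan ℝ (U i)) ∈ Metric.ball y ε := by
      rw [Metric.mem_ball, Subtype.dist_eq, dist_eq_norm, add_sub_cancel_left]
      exact hvr.trans_lt hr.2
    exact hball this
  obtain ⟨r, h, hr⟩ := (h.and self_mem_nhdsWithin).exists
  exact ⟨r, hr, h⟩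

/-! ### Error bound for the common fixed points. -/

section ErrorBound

variable [FiniteDimensional ℝ X]

/-- Test the normal vector `a` at the point of the relative ball around `c` farthest in the
direction of its projection. -/
theorem mul_norm_starProjection_le {C : Set X} {L : Submodule ℝ X} {c p a : X} {r : ℝ}
    (hr : 0 ≤ r) (hball : ∀ v ∈ L, ‖v‖ ≤ r → c + v ∈ C)
    (ha : ∀ w ∈ C, inner ℝ a (w - p) ≤ 0) :
    r * ‖L.starProjection a‖ ≤ inner ℝ a (p - c) := by
  set u := L.starProjection a with hu
  have hinner : inner ℝ a u = ‖u‖ ^ 2 := by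
    rw [← real_inner_self_eq_norm_sq, ← sub_eq_zero, ← inner_sub_left]
    exact L.starProjection_inner_eq_zero a u (L.starProjection_apply_mem a)
  rcases eq_or_ne u 0 with h0 | h0
  · have := ha _ (hball 0 L.zero_mem (by simpa using hr))
    rw [add_zero, ← neg_sub, inner_neg_right] at this
    rw [h0, norm_zero, mul_zero]
    linarith
  · have hpos : 0 < ‖u‖ := norm_pos_iff.2 h0
    have := ha _ (hball ((r / ‖u‖) • u) (L.smul_mem _ (L.starProjection_apply_mem a)) (by
      rw [norm_smul, Real.norm_of_nonneg (by positivity), div_mul_cancel₀ _ hpos.ne']))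
    have h1 : c + (r / ‖u‖) • u - p = (r / ‖u‖) • u - (p - c) := by abel
    rw [h1, inner_sub_right, inner_smul_right, hinner] at this
    have h2 : r / ‖u‖ * ‖u‖ ^ 2 = r * ‖u‖ := by field_simp
    linarith

/-- If the Douglas--Rachford step of `(A, B)` is short, then `x - P_A x` is nearly orthogonal
to the directions of `A` and `B`. -/
theorem norm_starProjection_sub_proj_le {A B : Set X} {L L' : Submodule ℝ X} {c x : X}
    {r M δ : ℝ} (hr : 0 < r)
    (hAcl : IsClosed A) (hAcv : Convex ℝ A) (hBcl : IsClosed B) (hBcv : Convex ℝ B)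
    (hA : ∀ v ∈ L, ‖v‖ ≤ r → c + v ∈ A) (hB : ∀ v ∈ L', ‖v‖ ≤ r → c + v ∈ B)
    (hx : ‖x - c‖ ≤ M) (hδ : ‖douglasRachford A B x - x‖ ≤ δ) :
    ‖L.starProjection (x - proj A x)‖ ≤ 7 * M / r * δ ∧
    ‖L'.starProjection (x - proj A x)‖ ≤ (1 + 7 * M / r) * δ := by
  have hcA : c ∈ A := by simpa using hA 0 L.zero_mem (by simpa using hr.le)
  have hcB : c ∈ B := by simpa using hB 0 L'.zero_mem (by simpa using hr.le)
  have hδ0 : 0 ≤ δ := (norm_nonneg _).trans hδ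
  set p := proj A x with hp
  set q := proj B (reflector A x) with hq
  have hdr : douglasRachford A B x - x = -(p - q) := by
    rw [douglasRachford, ← hp, ← hq]; abel
  rw [hdr, norm_neg] at hδ
  have hR : reflector A x - q = (p - q) - (x - p) := by
    rw [reflector, ← hp, two_smul]; abel
  have h1 := mul_norm_starProjection_le hr.le hA
    (fun w hw => inner_sub_proj_le ⟨c, hcA⟩ hAcl hAcv x hw)
  have h2 := mul_norm_starProjection_le hr.le hB
    (fun w hw => inner_sub_proj_le ⟨c, hcB⟩ hBcl hBcv (reflector A x) hw)
  rw [← hp] at h1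
  rw [← hq, hR] at h2
  have ha : ‖x - p‖ ≤ M := (norm_sub_proj_le ⟨c, hcA⟩ hAcl hAcv x hcA).trans hx
  have hpc : ‖p - c‖ ≤ 2 * M := by
    have : p - c = (x - c) - (x - p) := by abel
    rw [this]
    linarith [norm_sub_le (x - c) (x - p)]
  have hqc : ‖q - c‖ ≤ 6 * M := by
    have h3 := norm_sub_proj_le ⟨c, hcB⟩ hBcl hBcv (reflector A x) hcB
    have h4 : reflector A x - c = (p - c) - (x - p) := by
      rw [reflector, ← hp, two_smul]; abel
    have h5 : q - c = (reflector A x - c) - (reflector A x - q) := by abel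
    have h6 := norm_sub_le (p - c) (x - p)
    rw [← h4] at h6
    rw [h5]
    linarith [norm_sub_le (reflector A x - c) (reflector A x - q)]
  -- The normals at `p` and `q` cancel up to `p - q`, so the sum is small. Both terms are
  -- nonnegative by `h1` and `h2`, so each is small.
  have hsum : inner ℝ (x - p) (p - c) + inner ℝ ((p - q) - (x - p)) (q - c) ≤ 7 * M * δ := by
    have h3 : inner ℝ (x - p) (p - c) + inner ℝ ((p - q) - (x - p)) (q - c) =
        inner ℝ (x - p) (p - q) + inner ℝ (p - q) (q - c) := by
      simp only [inner_sub_left, inner_sub_right]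
      ring
    rw [h3]
    have h4 := (real_inner_le_norm (x - p) (p - q)).trans
      (mul_le_mul ha hδ (norm_nonneg _) ((norm_nonneg _).trans ha))
    have h5 := (real_inner_le_norm (p - q) (q - c)).trans
      (mul_le_mul hδ hqc (norm_nonneg _) hδ0)
    linarith
  have hn1 := mul_nonneg hr.le (norm_nonneg (L.starProjection (x - p)))
  have hn2 := mul_nonneg hr.le (norm_nonneg (L'.starProjection ((p - q) - (x - p))))
  have hk1 : ‖L.starProjection (x - p)‖ ≤ 7 * M / r * δ := by
    rw [div_mul_eq_mul_div, le_div_iff₀' hr]; linarith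
  have hk2 : ‖L'.starProjection ((p - q) - (x - p))‖ ≤ 7 * M / r * δ := by
    rw [div_mul_eq_mul_div, le_div_iff₀' hr]; linarith
  refine ⟨hk1, ?_⟩
  have h7 : x - p = (p - q) - ((p - q) - (x - p)) := by abel
  rw [h7, map_sub]
  have h8 := L'.norm_starProjection_apply_le (p - q)
  linarith [norm_sub_le (L'.starProjection (p - q)) (L'.starProjection ((p - q) - (x - p)))]

theorem proj_eq_of_orthogonal {C : Set X} (hcl : IsClosed C) (hcv : Convex ℝ C)
    {L : Submodule ℝ X} {c y z : X} (hL : ∀ v ∈ C, v - c ∈ L) (hz : z ∈ C)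
    (hy : ∀ v ∈ L, inner ℝ (y - z) v = 0) : proj C y = z :=
  proj_eq_of_inner hcl hcv hz fun w hw => by
    rw [hy (w - z) (by simpa using L.sub_mem (hL w hw) (hL z hz))]

/-- Reflection in `A` turns `y - z` into its negative, still orthogonal to `L'`, so both projections
equal `z`. -/
theorem douglasRachford_eq_of_orthogonal {A B : Set X} (hAcl : IsClosed A) (hAcv : Convex ℝ A)
    (hBcl : IsClosed B) (hBcv : Convex ℝ B) {L L' : Submodule ℝ X} {c y z : X}
    (hL : ∀ v ∈ A, v - c ∈ L) (hL' : ∀ v ∈ B, v - c ∈ L') (hzA : z ∈ A) (hzB : z ∈ B)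
    (hy : ∀ v ∈ L, inner ℝ (y - z) v = 0) (hy' : ∀ v ∈ L', inner ℝ (y - z) v = 0) :
    douglasRachford A B y = y := by
  have h1 : reflector A y - z = -(y - z) := by
    rw [reflector, proj_eq_of_orthogonal hAcl hAcv hL hzA hy, two_smul]; abel
  have h2 : proj B (reflector A y) = z :=
    proj_eq_of_orthogonal hBcl hBcv hL' hzB fun v hv => by
      rw [h1, inner_neg_left, hy' v hv, neg_zero]
  rw [douglasRachford, h2, proj_eq_of_orthogonal hAcl hAcv hL hzA hy]
  abel

/-- Bounded linear regularity of convex sets with relative interior point `c`. -/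
theorem exists_mem_norm_sub_le {ι : Type*} [Fintype ι] (U : ι → Set X)
    (hcv : ∀ i, Convex ℝ (U i)) (L : ι → Submodule ℝ X) (c : X) {r : ℝ} (hr : 0 < r)
    (hball : ∀ i, ∀ v ∈ L i, ‖v‖ ≤ r → c + v ∈ U i) (hL : ∀ i, ∀ v ∈ U i, v - c ∈ L i)
    (M : ℝ) :
    ∃ K : ℝ, 0 ≤ K ∧ ∀ (p : X) (δ : ℝ), 0 ≤ δ → ‖p - c‖ ≤ M →
      (∀ i, ∃ u ∈ U i, ‖u - p‖ ≤ δ) → ∃ z, (∀ i, z ∈ U i) ∧ ‖p - z‖ ≤ K * δ := by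
  obtain ⟨K, hK, h⟩ := exists_norm_sub_le_of_linearMap
    (fun i => (((L i)ᗮ.starProjection : X →L[ℝ] X) : X →ₗ[ℝ] X))
  rcases lt_or_ge M 0 with hM | hM
  · exact ⟨0, le_rfl, fun p δ _ hp => absurd ((norm_nonneg _).trans hp) hM.not_ge⟩
  refine ⟨2 * K + (K + 1) / r * M, by positivity, fun p δ hδ hp hu => ?_⟩
  obtain ⟨w, hw0, hw⟩ := h (p - c) δ hδ fun i => by
    obtain ⟨u, hu, hup⟩ := hu i
    have h1 : (L i)ᗮ.starProjection (u - c) = 0 :=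
      (L i)ᗮ.starProjection_apply_eq_zero_iff.2 (by
        rw [Submodule.orthogonal_orthogonal]; exact hL i u hu)
    have h2 : p - c = (u - c) - (u - p) := by abel
    rw [ContinuousLinearMap.coe_coe, h2, map_sub, h1, zero_sub, norm_neg]
    exact ((L i)ᗮ.norm_starProjection_apply_le _).trans hup
  have hwL : ∀ i, w ∈ L i := fun i => by
    have := (L i)ᗮ.starProjection_apply_eq_zero_iff.1 (hw0 i)
    rwa [Submodule.orthogonal_orthogonal] at this
  -- `c + w` lies in all affine hulls, within `K * δ` of `p`, hence within `e` of each `U i`.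
  set e := (K + 1) * δ with he
  have he0 : 0 ≤ e := by positivity
  have hre : 0 < r + e := by linarith
  have hue : ∀ i, ∃ u ∈ U i, ‖c + w - u‖ ≤ e := fun i => by
    obtain ⟨u, hu, hup⟩ := hu i
    refine ⟨u, hu, ?_⟩
    have h1 : c + w - u = -(p - c - w) - (u - p) := by abel
    rw [h1]
    have h2 := norm_sub_le (-(p - c - w)) (u - p)
    rw [norm_neg] at h2
    linarith
  -- Shrinking `c + w` towards `c` by this factor makes it a convex combination of `u` and a point
  -- of the ball around `c`.
  refine ⟨c + (r / (r + e)) • w, fun i => ?_, ?_⟩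
  · obtain ⟨u, hu, hue⟩ := hue i
    rcases he0.eq_or_lt with h0 | hpos
    · rw [← h0] at hue ⊢
      rw [add_zero, div_self hr.ne', one_smul, sub_eq_zero.1 (norm_le_zero_iff.1 hue)]
      exact hu
    · have hv : c + (r / e) • (c + w - u) ∈ U i := by
        refine hball i _ ((L i).smul_mem _ ?_) ?_
        · have h1 : c + w - u = w - (u - c) := by abel
          rw [h1]
          exact (L i).sub_mem (hwL i) (hL i u hu)
        · rw [norm_smul, Real.norm_of_nonneg (by positivity), div_mul_eq_mul_div,
            div_le_iff₀ hpos]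
          exact mul_le_mul_of_nonneg_left hue hr.le
      have := hcv i hu hv (a := r / (r + e)) (b := e / (r + e)) (by positivity) (by positivity)
        (by rw [← add_div, div_self hre.ne'])
      convert this using 1
      match_scalars <;> field_simp <;> ring
  · have h1 : p - (c + (r / (r + e)) • w) = (p - c - w) + (e / (r + e)) • w := by
      match_scalars <;> field_simp; ring
    have ht1 : e / (r + e) ≤ 1 := (div_le_one hre).2 (by linarith)
    have ht2 : e / (r + e) ≤ e / r := div_le_div_of_nonneg_left he0 hr (by linarith)
    have ht0 : 0 ≤ e / (r + e) := by positivity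
    have hwM : ‖w‖ ≤ M + K * δ := by
      have h2 : w = (p - c) - (p - c - w) := by abel
      rw [h2]
      linarith [norm_sub_le (p - c) (p - c - w)]
    have hKδ : 0 ≤ K * δ := by positivity
    have h3 : e / (r + e) * ‖w‖ ≤ e / r * M + K * δ := by
      calc e / (r + e) * ‖w‖ ≤ e / (r + e) * (M + K * δ) := mul_le_mul_of_nonneg_left hwM ht0
        _ = e / (r + e) * M + e / (r + e) * (K * δ) := by ring
        _ ≤ e / r * M + 1 * (K * δ) := add_le_add (mul_le_mul_of_nonneg_right ht2 hM)
            (mul_le_mul_of_nonneg_right ht1 hKδ)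
        _ = e / r * M + K * δ := by ring
    rw [h1]
    refine (norm_add_le _ _).trans ?_
    rw [norm_smul, Real.norm_of_nonneg ht0]
    have h4 : (2 * K + (K + 1) / r * M) * δ = 2 * (K * δ) + e / r * M := by
      rw [he]; ring
    rw [h4]
    linarith

/-- Error bound for the common fixed points of the cyclic Douglas--Rachford operators. The point
`y` below is a common fixed point, and `z` is its common projection. -/
theorem exists_orthogonal_norm_sub_le {m : ℕ} [NeZero m] (U : Fin m → Set X)
    (hcl : ∀ i, IsClosed (U i)) (hcv : ∀ i, Convex ℝ (U i)) (L : Fin m → Submodule ℝ X) (c : X)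
    {r : ℝ} (hr : 0 < r) (hball : ∀ i, ∀ v ∈ L i, ‖v‖ ≤ r → c + v ∈ U i)
    (hL : ∀ i, ∀ v ∈ U i, v - c ∈ L i) (M : ℝ) :
    ∃ K : ℝ, 0 ≤ K ∧ ∀ (x : X) (δ : ℝ), ‖x - c‖ ≤ M → (∀ i, ‖stepOp U i x - x‖ ≤ δ) →
      ∃ y z, ‖x - y‖ ≤ K * δ ∧ (∀ i, z ∈ U i) ∧ ∀ i, ∀ v ∈ L i, inner ℝ (y - z) v = 0 := by
  rcases lt_or_ge M 0 with hM | hM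
  · exact ⟨0, le_rfl, fun x δ hx => absurd ((norm_nonneg _).trans hx) hM.not_ge⟩
  obtain ⟨K₁, hK₁, h₁⟩ := exists_mem_norm_sub_le U hcv L c hr hball hL (2 * M)
  obtain ⟨K₂, hK₂, h₂⟩ := exists_norm_sub_le_of_linearMap
    (fun i => (((L i).starProjection : X →L[ℝ] X) : X →ₗ[ℝ] X))
  set C := 7 * M / r with hC
  have hC0 : 0 ≤ C := by positivity
  have hcU : ∀ i, c ∈ U i := fun i => by
    simpa using hball i 0 (L i).zero_mem (by simpa using hr.le)
  refine ⟨K₂ * (C + m * (3 + 2 * C)) + K₁ * (m * (3 + 2 * C)), by positivity,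
    fun x δ hx hstep => ?_⟩
  have hδ : 0 ≤ δ := (norm_nonneg _).trans (hstep 0)
  set p : Fin m → X := fun i => proj (U i) x with hp
  have hpU : ∀ i, p i ∈ U i := fun i => proj_mem ⟨c, hcU i⟩ (hcl i) (hcv i) x
  have hnear : ∀ i, ‖(L i).starProjection (x - p i)‖ ≤ C * δ ∧
      ‖(L (i + 1)).starProjection (x - p i)‖ ≤ (1 + C) * δ := fun i =>
    norm_starProjection_sub_proj_le hr (hcl i) (hcv i) (hcl _) (hcv _) (hball i) (hball _) hx
      (hstep i)
  have hsucc : ∀ i, ‖p (i + 1) - p i‖ ≤ (3 + 2 * C) * δ := fun i => by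
    set q := proj (U (i + 1)) (reflector (U i) x) with hq
    have hqU : q ∈ U (i + 1) := proj_mem ⟨c, hcU _⟩ (hcl _) (hcv _) _
    have hqp : ‖q - p i‖ ≤ δ := by
      have := hstep i
      have h3 : stepOp U i x - x = q - p i := by
        rw [stepOp, douglasRachford]; abel
      rwa [h3] at this
    have hmem : p (i + 1) - q ∈ L (i + 1) := by
      have := (L (i + 1)).sub_mem (hL _ _ (hpU (i + 1))) (hL _ _ hqU)
      simpa using this
    -- Being in `L (i + 1)`, this difference equals its own projection, and all three projected
    -- terms are small.
    have h4 : p (i + 1) - q = (L (i + 1)).starProjection (x - p i) -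
        (L (i + 1)).starProjection (x - p (i + 1)) - (L (i + 1)).starProjection (q - p i) := by
      have h3 : (x - p i) - (x - p (i + 1)) - (q - p i) = p (i + 1) - q := by abel
      rw [← map_sub, ← map_sub, h3, Submodule.starProjection_eq_self_iff.2 hmem]
    have h5 : p (i + 1) - p i = (p (i + 1) - q) + (q - p i) := by abel
    have h6 := (L (i + 1)).norm_starProjection_apply_le (q - p i)
    have h7 := norm_add_le (p (i + 1) - q) (q - p i)
    rw [← h5, h4] at h7
    have h8 := norm_sub_le ((L (i + 1)).starProjection (x - p i) -
        (L (i + 1)).starProjection (x - p (i + 1))) ((L (i + 1)).starProjection (q - p i))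
    have h9 := norm_sub_le ((L (i + 1)).starProjection (x - p i))
        ((L (i + 1)).starProjection (x - p (i + 1)))
    linarith [(hnear i).2, (hnear (i + 1)).1]
  have hchain : ∀ (k : ℕ) (hk : k < m), ‖p ⟨k, hk⟩ - p 0‖ ≤ k * ((3 + 2 * C) * δ) :=
      fun k => by
    induction k with
    | zero => intro hk; simp
    | succ k ih =>
      intro hk
      have h3 := hsucc ⟨k, k.lt_succ_self.trans hk⟩
      have h4 : (⟨k, k.lt_succ_self.trans hk⟩ : Fin m) + 1 = ⟨k + 1, hk⟩ :=
        Fin.ext (Fin.val_add_one_of_lt' hk)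
      rw [h4] at h3
      have h5 := norm_add_le (p ⟨k + 1, hk⟩ - p ⟨k, k.lt_succ_self.trans hk⟩)
        (p ⟨k, k.lt_succ_self.trans hk⟩ - p 0)
      rw [sub_add_sub_cancel] at h5
      push_cast
      linarith [ih (k.lt_succ_self.trans hk)]
  have hp0 : ∀ i, ‖p i - p 0‖ ≤ m * (3 + 2 * C) * δ := fun i => by
    refine (hchain i i.isLt).trans ?_
    rw [mul_assoc]
    exact mul_le_mul_of_nonneg_right (by exact_mod_cast i.isLt.le) (by positivity)
  have hpc : ‖p 0 - c‖ ≤ 2 * M := by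
    have h3 := norm_sub_proj_le ⟨c, hcU 0⟩ (hcl 0) (hcv 0) x (hcU 0)
    have h4 : p 0 - c = (x - c) - (x - p 0) := by abel
    rw [h4]
    linarith [norm_sub_le (x - c) (x - p 0)]
  obtain ⟨z, hz, hzp⟩ := h₁ (p 0) (m * (3 + 2 * C) * δ) (by positivity) hpc
    fun i => ⟨p i, hpU i, hp0 i⟩
  obtain ⟨w, hw0, hw⟩ := h₂ (x - p 0) ((C + m * (3 + 2 * C)) * δ) (by positivity) fun i => by
    have h3 : x - p 0 = (x - p i) + (p i - p 0) := by abel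
    rw [ContinuousLinearMap.coe_coe, h3, map_add]
    refine (norm_add_le _ _).trans ?_
    linarith [(hnear i).1, hp0 i, (L i).norm_starProjection_apply_le (p i - p 0)]
  refine ⟨z + w, z, ?_, hz, fun i v hv => ?_⟩
  · have h3 : x - (z + w) = (x - p 0 - w) + (p 0 - z) := by abel
    rw [h3]
    refine (norm_add_le _ _).trans ?_
    linarith
  · rw [add_sub_cancel_left, real_inner_comm]
    exact (L i).starProjection_apply_eq_zero_iff.1 (hw0 i) v hv

end ErrorBound

/-! ### From error bound to linear convergence. -/

section LinearConvergence

variable {E : Type*} [NormedAddCommGroup E]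

/-- A Fejer monotone iteration whose distance to the target set contracts converges linearly. -/
theorem exists_convergesLinearly_of_infDist [CompleteSpace E] {T : E → E} {F : Set E}
    (hne : F.Nonempty) (hcl : IsClosed F) (hT : ∀ x, ∀ y ∈ F, ‖T x - y‖ ≤ ‖x - y‖) {α : ℝ}
    (hα : 0 ≤ α) (hα1 : α < 1) (x : E)
    (hd : ∀ n, Metric.infDist (T^[n + 1] x) F ≤ α * Metric.infDist (T^[n] x) F) :
    ∃ l ∈ F, ConvergesLinearly (fun n => T^[n] x) l := by
  have hdn : ∀ n, Metric.infDist (T^[n] x) F ≤ Metric.infDist x F * α ^ n := fun n => by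
    induction n with
    | zero => simp
    | succ n ih =>
      refine (hd n).trans ((mul_le_mul_of_nonneg_left ih hα).trans_eq ?_)
      ring
  have hstep : ∀ n, dist (T^[n] x) (T^[n + 1] x) ≤ 2 * Metric.infDist x F * α ^ n := fun n => by
    refine le_trans ?_ ((mul_le_mul_of_nonneg_left (hdn n) zero_le_two).trans_eq (by ring))
    -- Both iterates are about as close to a nearly nearest `y` in `F`, by Fejér monotonicity.
    refine le_of_forall_pos_le_add fun ε hε => ?_
    obtain ⟨y, hy, hyd⟩ := (Metric.infDist_lt_iff hne).1
      (show Metric.infDist (T^[n] x) F < Metric.infDist (T^[n] x) F + ε / 2 by linarith)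
    have h1 := hT (T^[n] x) y hy
    rw [← dist_eq_norm, ← dist_eq_norm, ← Function.iterate_succ_apply' T] at h1
    linarith [dist_triangle_right (T^[n] x) (T^[n + 1] x) y]
  obtain ⟨l, hl⟩ := cauchySeq_tendsto_of_complete (cauchySeq_of_le_geometric α _ hα1 hstep)
  refine ⟨l, ?_, 2 * Metric.infDist x F / (1 - α), α,
    div_nonneg (mul_nonneg zero_le_two Metric.infDist_nonneg) (by linarith), hα, hα1,
    fun n => ?_⟩
  · rw [hcl.mem_iff_infDist_zero hne]
    have h1 := ((Metric.continuous_infDist_pt F).tendsto l).comp hl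
    have h2 : Tendsto (fun n => Metric.infDist x F * α ^ n) atTop (𝓝 0) := by
      simpa using (tendsto_pow_atTop_nhds_zero_of_lt_one hα hα1).const_mul (Metric.infDist x F)
    exact le_antisymm (le_of_tendsto_of_tendsto' h1 h2 hdn) Metric.infDist_nonneg
  · have := dist_le_of_le_geometric_of_tendsto α _ hα1 hstep hl n
    rw [dist_eq_norm] at this
    rwa [div_mul_eq_mul_div]

/-- Linear convergence of the cyclic composition of firmly nonexpansive maps under an error bound
on bounded sets. -/
theorem exists_convergesLinearly_foldl [ProperSpace E] {m : ℕ} (f : Fin m → E → E)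
    (hf : ∀ i x y, ‖f i x - f i y‖ ^ 2 + ‖(x - f i x) - (y - f i y)‖ ^ 2 ≤ ‖x - y‖ ^ 2)
    {c : E} (hc : ∀ i, f i c = c)
    (herr : ∀ M : ℝ, ∃ K : ℝ, 0 ≤ K ∧ ∀ (x : E) (δ : ℝ), 0 ≤ δ → ‖x - c‖ ≤ M →
      (∀ i, ‖f i x - x‖ ≤ δ) → ∃ y, (∀ i, f i y = y) ∧ ‖x - y‖ ≤ K * δ) (x₀ : E) :
    ∃ l ∈ ⋂ i, Function.fixedPoints (f i),
      ConvergesLinearly (fun n => (fun x => (List.finRange m).foldl (fun z i => f i z) x)^[n] x₀)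
        l := by
  set F : Set E := ⋂ i, Function.fixedPoints (f i) with hF
  set T : E → E := fun x => (List.finRange m).foldl (fun z i => f i z) x with hTdef
  have hmemF : ∀ y, y ∈ F ↔ ∀ i, f i y = y := fun y => by
    rw [hF, mem_iInter]; rfl
  have hcF : c ∈ F := (hmemF c).2 hc
  have hcont : ∀ i, Continuous (f i) := fun i => by
    refine (LipschitzWith.of_dist_le_mul (K := 1) fun x y => ?_).continuous
    rw [dist_eq_norm, dist_eq_norm, NNReal.coe_one, one_mul]
    exact le_of_pow_le_pow_left₀ two_ne_zero (norm_nonneg _)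
      (by linarith [hf i x y, sq_nonneg ‖(x - f i x) - (y - f i y)‖])
  have hFcl : IsClosed F := isClosed_iInter fun i => isClosed_fixedPoints (hcont i)
  have hT : ∀ x, ∀ y ∈ F, ‖T x - y‖ ≤ ‖x - y‖ := fun x y hy =>
    (norm_sub_le_of_foldl f hf ((hmemF y).1 hy) _ x).1
  have hbdd : ∀ n, ‖T^[n] x₀ - c‖ ≤ ‖x₀ - c‖ := fun n => by
    induction n with
    | zero => simp
    | succ n ih =>
      rw [Function.iterate_succ_apply']
      exact (hT _ c hcF).trans ih
  obtain ⟨K, hK, hKerr⟩ := herr ‖x₀ - c‖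
  -- The summand `1` makes `Q ≥ 1`, so that `1 - 1 / Q` is a nonnegative contraction factor for
  -- squared distances.
  set Q := (K * (2 * m)) ^ 2 + 1 with hQ
  have hQ1 : 1 ≤ Q := by linarith [sq_nonneg (K * (2 * m))]
  have hQ0 : 0 < Q := by linarith
  have hQle : 0 ≤ 1 - 1 / Q := by
    rw [sub_nonneg, div_le_one hQ0]; exact hQ1
  refine exists_convergesLinearly_of_infDist (α := √(1 - 1 / Q)) ⟨c, hcF⟩ hFcl hT
    (Real.sqrt_nonneg _) ?_ x₀ fun n => ?_
  · rw [Real.sqrt_lt' one_pos]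
    have : 0 < 1 / Q := by positivity
    linarith
  rw [Function.iterate_succ_apply']
  have hxc := hbdd n
  set x := T^[n] x₀
  obtain ⟨y, hy, hyd⟩ := hFcl.exists_infDist_eq_dist ⟨c, hcF⟩ x
  have hle := hT x y hy
  have hD : 0 ≤ ‖x - y‖ ^ 2 - ‖T x - y‖ ^ 2 :=
    sub_nonneg.2 (pow_le_pow_left₀ (norm_nonneg _) hle 2)
  -- `D` is the square root of the decrease of the squared distance to the nearest fixed point `y`.
  have hdisp := (norm_sub_le_of_foldl f hf ((hmemF y).1 hy) (List.finRange m) x).2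
    _ (Real.sqrt_nonneg _) (Real.sq_sqrt hD).ge
  rw [List.length_finRange] at hdisp
  obtain ⟨y', hy', hxy'⟩ := hKerr x _ (by positivity) hxc
    fun i => hdisp i (List.mem_finRange i)
  have h1 : ‖x - y‖ ≤ K * (2 * m) * √(‖x - y‖ ^ 2 - ‖T x - y‖ ^ 2) := by
    rw [← dist_eq_norm, ← hyd, mul_assoc]
    refine (Metric.infDist_le_dist_of_mem ((hmemF y').2 hy')).trans ?_
    rwa [dist_eq_norm, hyd, dist_eq_norm]
  have h2 : ‖x - y‖ ^ 2 ≤ Q * (‖x - y‖ ^ 2 - ‖T x - y‖ ^ 2) := by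
    refine (pow_le_pow_left₀ (norm_nonneg _) h1 2).trans ?_
    rw [mul_pow, Real.sq_sqrt hD]
    exact mul_le_mul_of_nonneg_right (by linarith) hD
  have h3 : ‖T x - y‖ ^ 2 ≤ (1 - 1 / Q) * ‖x - y‖ ^ 2 := by
    rw [← div_le_iff₀' hQ0] at h2
    have : (1 - 1 / Q) * ‖x - y‖ ^ 2 = ‖x - y‖ ^ 2 - ‖x - y‖ ^ 2 / Q := by ring
    linarith
  refine (Metric.infDist_le_dist_of_mem hy).trans ?_
  rw [hyd, dist_eq_norm, dist_eq_norm]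
  refine le_of_pow_le_pow_left₀ two_ne_zero (by positivity) ?_
  rwa [mul_pow, Real.sq_sqrt hQle]

end LinearConvergence

end BorweinTam

theorem corollary7p2 {X : Type*} [NormedAddCommGroup X] [InnerProductSpace ℝ X]
    [FiniteDimensional ℝ X] (m : ℕ) [NeZero m] (U : Fin m → Set X)
    (hclosed : ∀ i, IsClosed (U i)) (hconvex : ∀ i, Convex ℝ (U i))
    (hri : (⋂ i, intrinsicInterior ℝ (U i)).Nonempty) (x₀ : X) :
    ∃ xbar ∈ ⋂ i, Function.fixedPoints (BorweinTam.stepOp U i),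
      (∃ p ∈ ⋂ i, U i, ∀ i, BorweinTam.proj (U i) xbar = p) ∧
      BorweinTam.ConvergesLinearly (fun n => (BorweinTam.borweinTam U)^[n] x₀) xbar := by
  obtain ⟨c, hc⟩ := hri
  rw [mem_iInter] at hc
  have hcU : ∀ i, c ∈ U i := fun i => intrinsicInterior_subset (hc i)
  obtain ⟨r, hr, hball⟩ := BorweinTam.exists_forall_add_mem_of_mem_intrinsicInterior U hc
  have hL : ∀ i, ∀ v ∈ U i, v - c ∈ (affineSpan ℝ (U i)).direction := fun i v hv =>
    AffineSubspace.vsub_mem_direction (subset_affineSpan ℝ _ hv) (subset_affineSpan ℝ _ (hcU i))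
  have hfix : ∀ y z, (∀ i, z ∈ U i) →
      (∀ i, ∀ v ∈ (affineSpan ℝ (U i)).direction, inner ℝ (y - z) v = 0) →
      ∀ i, BorweinTam.stepOp U i y = y := fun y z hz hy i =>
    BorweinTam.douglasRachford_eq_of_orthogonal (hclosed i) (hconvex i) (hclosed _) (hconvex _)
      (hL i) (hL _) (hz i) (hz _) (hy i) (hy _)
  have herr := BorweinTam.exists_orthogonal_norm_sub_le U hclosed hconvex
    (fun i => (affineSpan ℝ (U i)).direction) c hr hball hL
  have hproper : ProperSpace X := FiniteDimensional.proper ℝ X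
  obtain ⟨l, hl, hconv⟩ := BorweinTam.exists_convergesLinearly_foldl (BorweinTam.stepOp U)
    (fun i => BorweinTam.douglasRachford_firmlyNonexpansive ⟨c, hcU i⟩ (hclosed i) (hconvex i)
      ⟨c, hcU _⟩ (hclosed _) (hconvex _))
    (hfix c c hcU fun i v _ => by rw [sub_self, inner_zero_left])
    (fun M => by
      obtain ⟨K, hK, h⟩ := herr M
      refine ⟨K, hK, fun x δ _ hx hstep => ?_⟩
      obtain ⟨y, z, hxy, hz, hyz⟩ := h x δ hx hstep
      exact ⟨y, hfix y z hz hyz, hxy⟩) x₀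
  refine ⟨l, hl, ?_, hconv⟩
  rw [mem_iInter] at hl
  -- With `δ = 0` the error bound forces `y = l`, so the limit itself splits into a common point `z`
  -- and an orthogonal part.
  obtain ⟨K, -, h⟩ := herr ‖l - c‖
  obtain ⟨y, z, hxy, hz, hyz⟩ := h l 0 le_rfl fun i => by
    rw [show BorweinTam.stepOp U i l = l from hl i, sub_self, norm_zero]
  rw [mul_zero, norm_le_zero_iff, sub_eq_zero] at hxy
  subst hxy
  exact ⟨z, mem_iInter.2 hz, fun i =>
    BorweinTam.proj_eq_of_orthogonal (hclosed i) (hconvex i) (hL i) (hz i) (hyz i)⟩
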